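/- Let $F_2$ be the free group of rank $2$ and $F_\omega$ the free group of countably infinite rank. An action of a group $G$ on a set $X$ with $|X|\ge 2$ is sharply $2$-transitive if, for any two ordered pairs of distinct elements of $X$, there is a unique $g\in G$ mapping the first pair to the second; a group is sharply $2$-transitive if it has a sharply $2$-transitive action on some set. A sharply $2$-transitive group is split if it contains a non-trivial normal abelian subgroup, and non-split otherwise. Theorem. The group $\mathrm{SL}_3(\mathbb{Z})$ contains a non-split sharply $2$-transitive subgroup. More precisely, there is an injective group homomorphism $f : (F_2\times\mathbb{Z}/2\mathbb{Z}) * F_2 \to \mathrm{SL}_3(\mathbb{Z})$ and a subgroup $H$ of the image of $f$ such that $H$ is isomorphic to $(F_\omega\times\mathbb{Z}/2\mathbb{Z}) * F_\omega$, and $H$ is sharply $2$-transitive and non-split. -/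

import Mathlib

universe u v

/-- The action of `G` on `X` is sharply `n`-transitive: `X` has at least `n` elements and, for any
two `n`-tuples of distinct elements of `X`, exactly one element of `G` maps the first to the
second. -/
def IsSharplyTransitiveAction (n : ℕ) (G : Type u) (X : Type v) [Group G] [MulAction G X] : Prop :=
  Nonempty (Fin n ↪ X) ∧ ∀ x y : Fin n ↪ X, ∃! g : G, ∀ i, g • x i = y i

/-- The group `G` is sharply `n`-transitive: it has a sharply `n`-transitive action on some set.
(For `n ≥ 1` such an action is transitive, so the set is in bijection with a set of cosets of `G`
and the universe of `G` is large enough.) -/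
def IsSharplyTransitiveGroup (n : ℕ) (G : Type u) [Group G] : Prop :=
  ∃ (X : Type u) (_ : MulAction G X), IsSharplyTransitiveAction n G X

/-- `G` contains a non-trivial normal abelian subgroup. A sharply 2-transitive group with this
property is called split. -/
def IsSplitGroup (G : Type u) [Group G] : Prop :=
  ∃ N : Subgroup G, N ≠ ⊥ ∧ N.Normal ∧ ∀ a ∈ N, ∀ b ∈ N, a * b = b * a

/-- The group `(F × ℤ/2ℤ) * F`, where `F` is the free group on `α`. -/
abbrev FreeProdGroup (α : Type u) : Type u :=
  Monoid.Coprod (FreeGroup α × Multiplicative (ZMod 2)) (FreeGroup α)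

/-! A sharply 2-transitive action is one that is regular on ordered pairs of distinct points. For G
= (F_ω × ℤ/2) * F_ω such an action, with the involution t acting without fixed points on a countable
set, is a limit of finite partial actions of the generators. Freeness on pairs is carried along as a
potential: a G-valued function on pairs that each edge multiplies on the left by its label. Letters
become total by sending points to fresh orbits of t (`PartialAction.exists_edge`), and transitivity
is forced by joining (o, t o) to each pair (x, y) through an unused generator
(`PartialAction.exists_connected`). Since t reverses (o, t o), a generator of the second free factor
may be used only if nothing reverses (x, y) yet. Otherwise (x, y) is already connected to some (b, t
b), and a generator commuting with t joins (o, t o) to that pair.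

A non-trivial abelian normal subgroup would act regularly on points and contain t, but t does not
commute with all its conjugates (`not_isSplitGroup_freeProdGroup`).

For the linear part, conjugation of a and b by powers of d embeds `FreeProdGroup ℤ` in (⟨a, d⟩ ×
⟨t⟩) * ⟨b⟩ with ⟨a, d⟩ free (`conjHom_injective`). That group embeds in SL₃(ℤ) by ping-pong between
the vectors near the line of (1, 1, 1) and those far from a plane containing it
(`SLThree.injective_lift_factorHom`). The rank two group lies in `FreeProdGroup ℤ` and, by the same
conjugation trick, contains the group of infinite rank. -/

/-! ### Labelled graphs, their components and potentials. -/

/-- The points `p` and `q` lie in the same component of the graph whose edges, labelled by elements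
of `G`, are given by `step`. -/
def Connected {G : Type*} {P : Type*} (step : G → P → P → Prop) : P → P → Prop :=
  Relation.EqvGen fun p q => ∃ g, step g p q

namespace Connected

variable {G : Type*} {P : Type*} {step step' : G → P → P → Prop} {p q r : P}

theorem of_step {g : G} (h : step g p q) : Connected step p q := Relation.EqvGen.rel _ _ ⟨g, h⟩

theorem refl (p : P) : Connected step p p := Relation.EqvGen.refl _

theorem symm (h : Connected step p q) : Connected step q p := Relation.EqvGen.symm _ _ h

theorem trans (h : Connected step p q) (h' : Connected step q r) : Connected step p r :=
  Relation.EqvGen.trans _ _ _ h h'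

theorem mono (hs : ∀ g p q, step g p q → step' g p q) (h : Connected step p q) :
    Connected step' p q :=
  Relation.EqvGen.mono (fun _ _ ⟨g, hg⟩ => ⟨g, hs _ _ _ hg⟩) _ _ h

theorem apply_eq {K : Type*} {F : P → K} (hF : ∀ g p q, step g p q → F p = F q)
    (h : Connected step p q) : F p = F q := by
  induction h with
  | rel x y h => exact hF _ _ _ h.choose_spec
  | refl x => rfl
  | symm x y _ ih => exact ih.symm
  | trans x y z _ _ ih₁ ih₂ => exact ih₁.trans ih₂

theorem map {F : P → P} (hF : ∀ g p q, step g p q → step g (F p) (F q))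
    (h : Connected step p q) : Connected step (F p) (F q) := by
  induction h with
  | rel x y h => exact of_step (hF _ _ _ h.choose_spec)
  | refl x => exact refl _
  | symm x y _ ih => exact ih.symm
  | trans x y z _ _ ih₁ ih₂ => exact ih₁.trans ih₂

end Connected

/-- A potential of a labelled graph: a map to the group that turns the edges into left
multiplications by their labels. -/
def IsPotential {G : Type*} [Group G] {P : Type*} (step : G → P → P → Prop) (c : P → G) : Prop :=
  ∀ g p q, step g p q → c q = g * c p

/-- The graph with labelled edges `step` and the additional edges `A` with label `h`. -/
def joinStep {G : Type*} [Group G] {P : Type*} (step : G → P → P → Prop) (h : G)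
    (A : P → P → Prop) : G → P → P → Prop :=
  fun g p q => step g p q ∨ (g = h ∧ A p q) ∨ (g = h⁻¹ ∧ A q p)

section Join

variable {G : Type*} [Group G] {P : Type*} {step : G → P → P → Prop} {h : G} {A : P → P → Prop}
  {c : P → G}

open Classical in
/-- Attaching components, each by edges that require the same change of potential, to the rest of
the graph preserves the existence of a potential. -/
theorem exists_isPotential_joinStep (hc : IsPotential step c)
    (hsep : ∀ p q p' q', A p q → A p' q' → ¬ Connected step p q')
    (hcomp : ∀ p q p' q', A p q → A p' q' → Connected step q q' →
      (c q)⁻¹ * h * c p = (c q')⁻¹ * h * c p') :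
    ∃ c', IsPotential (joinStep step h A) c' := by
  let T : P → Prop := fun p => ∃ e : P × P, A e.1 e.2 ∧ Connected step p e.2
  -- Right multiplication by a function constant on old components respects all left labels. It
  -- corrects the components of targets; by `hsep` the sources keep their potential.
  let k : P → G := fun p =>
    if H : T p then (c H.choose.2)⁻¹ * h * c H.choose.1 else 1
  have hk : ∀ p e₁ e₂, A e₁ e₂ → Connected step p e₂ → k p = (c e₂)⁻¹ * h * c e₁ := by
    intro p e₁ e₂ he hp
    have H : T p := ⟨(e₁, e₂), he, hp⟩
    simp only [k, dif_pos H]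
    exact hcomp _ _ _ _ H.choose_spec.1 he (H.choose_spec.2.symm.trans hp)
  have hk1 : ∀ p, ¬ T p → k p = 1 := fun p H => by simp only [k, dif_neg H]
  have hkc : ∀ g p q, step g p q → k p = k q := by
    intro g p q hpq
    by_cases H : T p
    · obtain ⟨e, he, hp⟩ := H
      rw [hk p _ _ he hp, hk q _ _ he ((Connected.of_step hpq).symm.trans hp)]
    · rw [hk1 p H, hk1 q fun ⟨e, he, hq⟩ => H ⟨e, he, (Connected.of_step hpq).trans hq⟩]
  have hA : ∀ p q, A p q → c q * k q = h * (c p * k p) := by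
    intro p q hpq
    rw [hk q p q hpq (Connected.refl q),
      hk1 p fun ⟨e, he, hp⟩ => hsep _ _ _ _ hpq he hp]
    group
  refine ⟨fun p => c p * k p, fun g p q hs => ?_⟩
  rcases hs with hs | ⟨rfl, hs⟩ | ⟨rfl, hs⟩
  · simp only [hc g p q hs, hkc g p q hs, mul_assoc]
  · exact hA p q hs
  · simp only [hA q p hs, inv_mul_cancel_left]

open Classical in
/-- Attaching components creates no new components that are invariant under `flip`, except those
that contain an old one. -/
theorem exists_connected_of_joinStep {flip : P → P} {D : P → Prop}
    (hflip : ∀ p, flip (flip p) = p)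
    (hstep : ∀ g p q, step g p q → step g (flip p) (flip q))
    (hA : ∀ p q, A p q → A (flip p) (flip q))
    (hsep : ∀ p q p' q', A p q → A p' q' → ¬ Connected step p q')
    (hcomp : ∀ p q p' q', A p q → A p' q' → Connected step q q' → Connected step p p')
    (hD : ∀ p, Connected step p (flip p) → ∃ d, D d ∧ Connected step p d)
    {p : P} (hp : Connected (joinStep step h A) p (flip p)) :
    ∃ d, D d ∧ Connected (joinStep step h A) p d := by
  let T : P → Prop := fun p => ∃ e : P × P, A e.1 e.2 ∧ Connected step p e.2
  -- Collapsing each attached component onto the source of one of its edges turns new connections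
  -- into old ones.
  let ρ : P → P := fun p => if H : T p then H.choose.1 else p
  have hsub : ∀ g p q, step g p q → joinStep step h A g p q := fun g p q => Or.inl
  have hρT : ∀ p e₁ e₂, A e₁ e₂ → Connected step p e₂ → Connected step (ρ p) e₁ := by
    intro p e₁ e₂ he hp
    have H : T p := ⟨(e₁, e₂), he, hp⟩
    simp only [ρ, dif_pos H]
    exact hcomp _ _ _ _ H.choose_spec.1 he (H.choose_spec.2.symm.trans hp)
  have hρ1 : ∀ p, ¬ T p → ρ p = p := fun p H => by simp only [ρ, dif_neg H]
  have hρA : ∀ p q, A p q → Connected step (ρ p) (ρ q) := by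
    intro p q hpq
    rw [hρ1 p fun ⟨e, he, hp⟩ => hsep _ _ _ _ hpq he hp]
    exact (hρT q p q hpq (Connected.refl q)).symm
  have hρs : ∀ g p q, joinStep step h A g p q → Connected step (ρ p) (ρ q) := by
    rintro g p q (hs | ⟨-, hs⟩ | ⟨-, hs⟩)
    · by_cases H : T p
      · obtain ⟨e, he, hp⟩ := H
        exact (hρT p _ _ he hp).trans
          (hρT q _ _ he ((Connected.of_step hs).symm.trans hp)).symm
      · rw [hρ1 p H, hρ1 q fun ⟨e, he, hq⟩ => H ⟨e, he, (Connected.of_step hs).trans hq⟩]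
        exact Connected.of_step hs
    · exact hρA p q hs
    · exact (hρA q p hs).symm
  have hρc : ∀ {p q}, Connected (joinStep step h A) p q → Connected step (ρ p) (ρ q) := by
    intro p q hpq
    induction hpq with
    | rel x y h => exact hρs _ _ _ h.choose_spec
    | refl x => exact Connected.refl _
    | symm x y _ ih => exact ih.symm
    | trans x y z _ _ ih₁ ih₂ => exact ih₁.trans ih₂
  have hp' := hρc hp
  by_cases H : T p
  · obtain ⟨e, he, hpe⟩ := H
    have h1 := hρT p _ _ he hpe
    have h2 := hρT (flip p) _ _ (hA _ _ he) (hpe.map hstep)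
    obtain ⟨d, hd, hed⟩ := hD e.1 (h1.symm.trans (hp'.trans h2))
    exact ⟨d, hd, ((hpe.mono hsub).trans
      (Connected.of_step (g := h) (Or.inr (Or.inl ⟨rfl, he⟩))).symm).trans (hed.mono hsub)⟩
  · have H' : ¬ T (flip p) := fun ⟨e, he, hpe⟩ =>
      H ⟨(flip e.1, flip e.2), hA _ _ he, by simpa only [hflip] using hpe.map hstep⟩
    rw [hρ1 p H, hρ1 _ H'] at hp'
    obtain ⟨d, hd, hed⟩ := hD p hp'
    exact ⟨d, hd, hed.mono hsub⟩

end Join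

/-! ### Finite partial actions and their extension by new edges. -/

/-- A countably infinite set with a fixed point free involution. -/
abbrev Pt : Type := ℕ × Bool

/-- The fixed point free involution of `Pt`. -/
def Pt.flip (x : Pt) : Pt := (x.1, !x.2)

@[simp] theorem Pt.flip_flip (x : Pt) : x.flip.flip = x := by simp [Pt.flip]

@[simp] theorem Pt.flip_ne (x : Pt) : x.flip ≠ x := by simp [Pt.flip, Prod.ext_iff]

@[simp] theorem Pt.ne_flip (x : Pt) : x ≠ x.flip := (Pt.flip_ne x).symm

@[simp] theorem Pt.flip_inj {x y : Pt} : x.flip = y.flip ↔ x = y :=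
  (Function.Involutive.injective Pt.flip_flip).eq_iff

/-- The action of the involution on pairs of points. -/
def flipPair (p : Pt × Pt) : Pt × Pt := (p.1.flip, p.2.flip)

/-- The inverse of a generator or of the inverse of a generator. -/
def letterInv {S : Type} (l : S × Bool) : S × Bool := (l.1, !l.2)

@[simp] theorem letterInv_letterInv {S : Type} (l : S × Bool) : letterInv (letterInv l) = l := by
  simp [letterInv]

@[simp] theorem letterInv_fst {S : Type} (l : S × Bool) : (letterInv l).1 = l.1 := rfl

@[simp] theorem letterInv_ne {S : Type} (l : S × Bool) : letterInv l ≠ l := by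
  simp [letterInv, Prod.ext_iff]

section

variable {G : Type} [Group G] {S : Type} (gen : S → G) (t : G)

/-- The value of a letter in the group. -/
def letterVal (l : S × Bool) : G := if l.2 then gen l.1 else (gen l.1)⁻¹

@[simp] theorem letterVal_letterInv (l : S × Bool) :
    letterVal gen (letterInv l) = (letterVal gen l)⁻¹ := by
  rcases l with ⟨s, b⟩
  cases b <;> simp [letterVal, letterInv]

/-- The graph on pairs of distinct points in which the involution and the letters act on both
points at once. -/
def pairStep (edge : S × Bool → Pt → Pt → Prop) : G → Pt × Pt → Pt × Pt → Prop :=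
  fun g p q => p.1 ≠ p.2 ∧ q.1 ≠ q.2 ∧ ((g = t ∧ q = flipPair p) ∨
    ∃ l, g = letterVal gen l ∧ edge l p.1 q.1 ∧ edge l p.2 q.2)

/-- A finite partial action on `Pt` of generators of a group `G` and the involution `t`. The
involution acts by `Pt.flip`, the other generators by partial injections, which commute with the
involution if the predicate `comm` holds. The induced partial action on pairs of distinct points is
free, and if it takes a pair to its reverse then also to a pair that is reversed by `t`. -/
structure PartialAction (comm : S → Prop) where
  edge : S × Bool → Pt → Pt → Prop
  finite : {e : (S × Bool) × Pt × Pt | edge e.1 e.2.1 e.2.2}.Finite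
  functional : ∀ {l x y y'}, edge l x y → edge l x y' → y = y'
  symm : ∀ {l x y}, edge l x y → edge (letterInv l) y x
  flip : ∀ {l x y}, comm l.1 → edge l x y → edge l x.flip y.flip
  potential : ∃ c, IsPotential (pairStep gen t edge) c
  diag : ∀ p : Pt × Pt, p.1 ≠ p.2 → Connected (pairStep gen t edge) p p.swap →
    ∃ b : Pt, Connected (pairStep gen t edge) p (b, b.flip)

variable {gen t} {comm : S → Prop}

theorem pairStep_mono {edge edge' : S × Bool → Pt → Pt → Prop}
    (h : ∀ l x y, edge l x y → edge' l x y) (g : G) (p q : Pt × Pt)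
    (hs : pairStep gen t edge g p q) : pairStep gen t edge' g p q := by
  obtain ⟨h1, h2, h3 | ⟨l, h3, h4, h5⟩⟩ := hs
  · exact ⟨h1, h2, Or.inl h3⟩
  · exact ⟨h1, h2, Or.inr ⟨l, h3, h _ _ _ h4, h _ _ _ h5⟩⟩

theorem pairStep_swap {edge : S × Bool → Pt → Pt → Prop} (g : G) (p q : Pt × Pt)
    (hs : pairStep gen t edge g p q) : pairStep gen t edge g p.swap q.swap := by
  obtain ⟨h1, h2, ⟨h3, rfl⟩ | ⟨l, h3, h4, h5⟩⟩ := hs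
  · exact ⟨h1.symm, h2.symm, Or.inl ⟨h3, rfl⟩⟩
  · exact ⟨h1.symm, h2.symm, Or.inr ⟨l, h3, h5, h4⟩⟩

theorem connected_flipPair {edge : S × Bool → Pt → Pt → Prop} {p : Pt × Pt} (hp : p.1 ≠ p.2) :
    Connected (pairStep gen t edge) p (flipPair p) :=
  Connected.of_step (g := t) ⟨hp, by simpa [flipPair] using hp, Or.inl ⟨rfl, rfl⟩⟩

theorem fst_eq_snd_iff_of_connected {edge : S × Bool → Pt → Pt → Prop} {p q : Pt × Pt}
    (h : Connected (pairStep gen t edge) p q) : p.1 = p.2 ↔ q.1 = q.2 := by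
  refine iff_of_eq (h.apply_eq (F := fun p : Pt × Pt => p.1 = p.2) fun g p q hs => ?_)
  simp only [hs.1, hs.2.1]

/-- A pair with a point `w` such that no letter is defined at `w` or at its image under the
involution is only connected to its image under the involution. -/
theorem eq_or_eq_flipPair_of_connected {edge : S × Bool → Pt → Pt → Prop}
    (hsymm : ∀ {l x y}, edge l x y → edge (letterInv l) y x) {q r : Pt × Pt}
    (hfree : ∃ w, (w = q.1 ∨ w = q.2) ∧ ∀ l y, ¬ edge l w y ∧ ¬ edge l w.flip y)
    (h : Connected (pairStep gen t edge) q r) : r = q ∨ r = flipPair q := by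
  obtain ⟨w, hw, hfree⟩ := hfree
  have key := h.apply_eq (F := fun p => p = q ∨ p = flipPair q) fun g p p' hs => ?_
  · exact (iff_of_eq key).1 (Or.inl rfl)
  · have hff : flipPair (flipPair q) = q := by simp [flipPair]
    obtain ⟨-, -, ⟨-, rfl⟩ | ⟨l, -, h4, h5⟩⟩ := hs
    · apply propext
      constructor
      · rintro (rfl | rfl)
        · exact Or.inr rfl
        · exact Or.inl hff
      · rintro (hq | hq)
        · right; rw [← hq]; simp [flipPair]
        · left
          simpa [flipPair] using congrArg flipPair hq
    · have key : ∀ p p' : Pt × Pt, ∀ l, edge l p.1 p'.1 → edge l p.2 p'.2 →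
          ¬ (p = q ∨ p = flipPair q) := by
        rintro p p' l h4 h5 (rfl | rfl) <;> rcases hw with rfl | rfl
        exacts [(hfree _ _).1 h4, (hfree _ _).1 h5, (hfree _ _).2 h4, (hfree _ _).2 h5]
      simp only [key _ _ _ h4 h5, key _ _ _ (hsymm h4) (hsymm h5)]

namespace PartialAction

/-- Extend the partial action of the letter `l` by the relation `N`. -/
theorem exists_extend (s : PartialAction gen t comm) (hcommute : ∀ i, comm i → Commute (gen i) t)
    (l : S × Bool) (N : Pt → Pt → Prop)
    (hfin : {e : Pt × Pt | N e.1 e.2}.Finite)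
    (M : Pt → Pt → Prop) (hM : ∀ x y, M x y ↔ s.edge l x y ∨ N x y)
    (hfun : ∀ {x y y'}, M x y → M x y' → y = y') (hinj : ∀ {x x' y}, M x y → M x' y → x = x')
    (hflip : ∀ {x y}, comm l.1 → N x y → N x.flip y.flip)
    (A : Pt × Pt → Pt × Pt → Prop) (hA : ∀ p q, A p q ↔
      p.1 ≠ p.2 ∧ q.1 ≠ q.2 ∧ M p.1 q.1 ∧ M p.2 q.2 ∧ (N p.1 q.1 ∨ N p.2 q.2))
    (hsep : ∀ p q p' q', A p q → A p' q' → ¬ Connected (pairStep gen t s.edge) p q')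
    (hcomp : ∀ p q p' q', A p q → A p' q' → Connected (pairStep gen t s.edge) q q' →
      (p' = p ∧ q' = q) ∨ (comm l.1 ∧ p' = flipPair p ∧ q' = flipPair q)) :
    ∃ s' : PartialAction gen t comm, (∀ l x y, s.edge l x y → s'.edge l x y) ∧
      ∀ x y, N x y → s'.edge l x y := by
  let E : S × Bool → Pt → Pt → Prop := fun l' x y =>
    s.edge l' x y ∨ (l' = l ∧ N x y) ∨ (l' = letterInv l ∧ N y x)
  have hEl : ∀ x y, E l x y ↔ M x y := fun x y => by
    simp [E, hM, (letterInv_ne l).symm]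
  have hsy : ∀ {l' x y}, s.edge (letterInv l') x y ↔ s.edge l' y x := fun {l' x y} =>
    ⟨fun h => by simpa using s.symm h, fun h => s.symm h⟩
  have hEinv : ∀ x y, E (letterInv l) x y ↔ M y x := fun x y => by
    simp [E, hM, hsy]
  have hEo : ∀ l' x y, l' ≠ l → l' ≠ letterInv l → (E l' x y ↔ s.edge l' x y) :=
    fun l' x y h h' => by simp [E, h, h']
  have hstep : pairStep gen t E = joinStep (pairStep gen t s.edge) (letterVal gen l) A := by
    funext g p q
    apply propext
    constructor
    · rintro ⟨h1, h2, h3 | ⟨l', h3, h4, h5⟩⟩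
      · exact Or.inl ⟨h1, h2, Or.inl h3⟩
      · by_cases hl : l' = l
        · subst hl
          rw [hEl] at h4 h5
          by_cases hN : N p.1 q.1 ∨ N p.2 q.2
          · exact Or.inr (Or.inl ⟨h3, (hA _ _).2 ⟨h1, h2, h4, h5, hN⟩⟩)
          · rw [not_or] at hN
            rw [hM] at h4 h5
            exact Or.inl ⟨h1, h2, Or.inr ⟨l', h3, h4.resolve_right hN.1, h5.resolve_right hN.2⟩⟩
        · by_cases hl' : l' = letterInv l
          · subst hl'
            rw [hEinv] at h4 h5
            by_cases hN : N q.1 p.1 ∨ N q.2 p.2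
            · exact Or.inr (Or.inr ⟨by simpa using h3, (hA _ _).2 ⟨h2, h1, h4, h5, hN⟩⟩)
            · rw [not_or] at hN
              rw [hM] at h4 h5
              exact Or.inl ⟨h1, h2, Or.inr ⟨_, h3, hsy.2 (h4.resolve_right hN.1),
                hsy.2 (h5.resolve_right hN.2)⟩⟩
          · rw [hEo _ _ _ hl hl'] at h4 h5
            exact Or.inl ⟨h1, h2, Or.inr ⟨l', h3, h4, h5⟩⟩
    · rintro (h | ⟨rfl, h⟩ | ⟨rfl, h⟩)
      · exact pairStep_mono (fun _ _ _ => Or.inl) _ _ _ h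
      · obtain ⟨h1, h2, h3, h4, -⟩ := (hA _ _).1 h
        exact ⟨h1, h2, Or.inr ⟨l, rfl, (hEl _ _).2 h3, (hEl _ _).2 h4⟩⟩
      · obtain ⟨h1, h2, h3, h4, -⟩ := (hA _ _).1 h
        exact ⟨h2, h1, Or.inr ⟨letterInv l, by simp, (hEinv _ _).2 h3, (hEinv _ _).2 h4⟩⟩
  obtain ⟨c, hc⟩ := s.potential
  have hpot : ∃ c, IsPotential (pairStep gen t E) c := by
    rw [hstep]
    refine exists_isPotential_joinStep hc hsep fun p q p' q' h h' hqq' => ?_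
    obtain ⟨rfl, rfl⟩ | ⟨hl, rfl, rfl⟩ := hcomp p q p' q' h h' hqq'
    · rfl
    · obtain ⟨h1, h2, -⟩ := (hA _ _).1 h
      -- An edge and its image under the involution need the same correction, because t cancels
      -- across the label.
      have hcl : Commute (letterVal gen l) t := by
        unfold letterVal
        split_ifs
        · exact hcommute _ hl
        · exact (hcommute _ hl).inv_left
      have e1 : ∀ r : Pt × Pt, r.1 ≠ r.2 → c (flipPair r) = t * c r := fun r hr =>
        hc t r _ ⟨hr, by simpa [flipPair] using hr, Or.inl ⟨rfl, rfl⟩⟩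
      rw [e1 p h1, e1 q h2]
      simp only [mul_inv_rev, mul_assoc]
      rw [← mul_assoc (letterVal gen l) t, hcl.eq]
      simp [mul_assoc]
  have hdiag : ∀ p : Pt × Pt, p.1 ≠ p.2 → Connected (pairStep gen t E) p p.swap →
      ∃ b : Pt, Connected (pairStep gen t E) p (b, b.flip) := by
    intro p hp hpp
    have hpp' := hpp
    rw [hstep] at hpp'
    obtain ⟨d, hd, hpd⟩ := exists_connected_of_joinStep
      (D := fun d : Pt × Pt => d.2 = d.1.flip ∨ d.1 = d.2)
      (fun p : Pt × Pt => Prod.swap_swap p) (fun g p q => pairStep_swap g p q) (fun p q h => by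
        obtain ⟨h1, h2, h3, h4, h5⟩ := (hA _ _).1 h
        exact (hA _ _).2 ⟨h1.symm, h2.symm, h4, h3, h5.symm⟩) hsep
      (fun p q p' q' h h' hqq' => by
        obtain ⟨rfl, rfl⟩ | ⟨hl, rfl, rfl⟩ := hcomp p q p' q' h h' hqq'
        · exact Connected.refl _
        · exact connected_flipPair ((hA _ _).1 h).1)
      (fun p hpp => by
        by_cases hp : p.1 = p.2
        · exact ⟨p, Or.inr hp, Connected.refl _⟩
        · obtain ⟨b, hb⟩ := s.diag p hp hpp
          exact ⟨_, Or.inl rfl, hb⟩) hpp'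
    rw [← hstep] at hpd
    rcases hd with hd | hd
    · exact ⟨d.1, by rwa [← hd]⟩
    · exact absurd ((fst_eq_snd_iff_of_connected hpd).2 hd) hp
  refine ⟨⟨E, ?_, ?_, ?_, ?_, hpot, hdiag⟩, fun _ _ _ => Or.inl, fun x y h =>
    Or.inr (Or.inl ⟨rfl, h⟩)⟩
  · refine (s.finite.union ((hfin.image fun e => (l, e.1, e.2)).union
      (hfin.image fun e => (letterInv l, e.2, e.1)))).subset ?_
    rintro ⟨l', x, y⟩ (h | ⟨rfl, h⟩ | ⟨rfl, h⟩)
    · exact Or.inl h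
    · exact Or.inr (Or.inl ⟨(x, y), h, rfl⟩)
    · exact Or.inr (Or.inr ⟨(y, x), h, rfl⟩)
  · intro l' x y y' h h'
    by_cases hl : l' = l
    · subst hl
      exact hfun ((hEl _ _).1 h) ((hEl _ _).1 h')
    · by_cases hl' : l' = letterInv l
      · subst hl'
        exact hinj ((hEinv _ _).1 h) ((hEinv _ _).1 h')
      · exact s.functional ((hEo _ _ _ hl hl').1 h) ((hEo _ _ _ hl hl').1 h')
  · rintro l' x y (h | ⟨rfl, h⟩ | ⟨rfl, h⟩)
    · exact Or.inl (s.symm h)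
    · exact Or.inr (Or.inr ⟨rfl, h⟩)
    · exact Or.inr (Or.inl ⟨by simp, h⟩)
  · rintro l' x y hl (h | ⟨rfl, h⟩ | ⟨rfl, h⟩)
    · exact Or.inl (s.flip hl h)
    · exact Or.inr (Or.inl ⟨rfl, hflip hl h⟩)
    · exact Or.inr (Or.inr ⟨rfl, hflip (by simpa using hl) h⟩)

end PartialAction

end

/-! ### Making letters total and pairs connected. -/

section

variable {G : Type} [Group G] {S : Type} {gen : S → G} {t : G} {comm : S → Prop}

namespace PartialAction

instance : Preorder (PartialAction gen t comm) where
  le s s' := ∀ l x y, s.edge l x y → s'.edge l x y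
  le_refl _ _ _ _ h := h
  le_trans _ _ _ h h' l x y he := h' l x y (h l x y he)

/-- Every partial action extends to one in which a given letter is defined at a given point. -/
theorem exists_edge (s : PartialAction gen t comm) (hcommute : ∀ i, comm i → Commute (gen i) t)
    (l : S × Bool) (a : Pt) : ∃ s', s ≤ s' ∧ ∃ y, s'.edge l a y := by
  by_cases hex : ∃ y, s.edge l a y
  · exact ⟨s, le_rfl, hex⟩
  -- A fresh orbit of the involution, touched by no edge and not containing `a`, receives the new
  -- target.
  obtain ⟨n, hn⟩ := ((s.finite.image fun e => e.2.1.1).union (Set.finite_singleton a.1)).exists_notMem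
  simp only [Set.mem_union, Set.mem_image, Set.mem_ofPred_eq, Set.mem_singleton_iff, not_or,
    not_exists, not_and] at hn
  obtain ⟨hn, hna⟩ := hn
  have hold : ∀ {l' u w}, s.edge l' u w → u.1 ≠ n := fun {l' u w} h => hn (l', u, w) h
  have hold' : ∀ {l' u w}, s.edge l' u w → w.1 ≠ n := fun h => hold (s.symm h)
  obtain ⟨x, rfl⟩ : ∃ x : Pt, x.1 = n := ⟨(n, true), rfl⟩
  have hx : ∀ w : Pt, w.1 = x.1 → ∀ l' u, ¬ s.edge l' u w := fun w hw l' u h => hold' h hw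
  have haf : comm l.1 → ∀ y, ¬ s.edge l a.flip y := fun hl y h =>
    hex ⟨y.flip, by simpa using s.flip hl h⟩
  let N : Pt → Pt → Prop := fun u w => (u = a ∧ w = x) ∨ (comm l.1 ∧ u = a.flip ∧ w = x.flip)
  let M : Pt → Pt → Prop := fun u w => s.edge l u w ∨ N u w
  let A : Pt × Pt → Pt × Pt → Prop := fun p q =>
    p.1 ≠ p.2 ∧ q.1 ≠ q.2 ∧ M p.1 q.1 ∧ M p.2 q.2 ∧ (N p.1 q.1 ∨ N p.2 q.2)
  have hNs : ∀ {u w}, N u w → ∀ y, ¬ s.edge l u y := by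
    rintro u w (⟨rfl, -⟩ | ⟨hl, rfl, -⟩) y h
    exacts [hex ⟨y, h⟩, haf hl y h]
  have hNt : ∀ {u w}, N u w → w.1 = x.1 := by
    rintro u w (⟨-, rfl⟩ | ⟨-, -, rfl⟩) <;> rfl
  have hinj : ∀ {u u' w}, M u w → M u' w → u = u' := by
    rintro u u' w (h | h) (h' | h')
    · exact s.functional (s.symm h) (s.symm h')
    · exact absurd h (hx _ (hNt h') _ _)
    · exact absurd h' (hx _ (hNt h) _ _)
    · rcases h with ⟨h1, h2⟩ | ⟨-, h1, h2⟩ <;> rcases h' with ⟨h3, h4⟩ | ⟨-, h3, h4⟩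
      exacts [h1.trans h3.symm, absurd (h2.symm.trans h4) (Pt.ne_flip x),
        absurd (h2.symm.trans h4) (Pt.flip_ne x), h1.trans h3.symm]
  have hMs : ∀ {u w}, M u w → u.1 ≠ x.1 := by
    rintro u w (h | ⟨rfl, -⟩ | ⟨-, rfl, -⟩)
    exacts [hold h, fun h => hna h.symm, fun h => hna h.symm]
  have hMf : comm l.1 → ∀ {u w}, M u w → M u.flip w.flip := by
    rintro hl u w (h | ⟨rfl, rfl⟩ | ⟨-, rfl, rfl⟩)
    · exact Or.inl (s.flip hl h)
    · exact Or.inr (Or.inr ⟨hl, rfl, rfl⟩)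
    · exact Or.inr (Or.inl ⟨by simp, by simp⟩)
  -- Each target pair of a new edge contains a fresh point, so its old component is as small as
  -- possible.
  have hfree : ∀ {p q}, A p q → ∀ {r}, Connected (pairStep gen t s.edge) q r →
      r = q ∨ r = flipPair q := by
    rintro p q ⟨-, -, -, -, h⟩ r hr
    refine eq_or_eq_flipPair_of_connected s.symm ?_ hr
    rcases h with h | h
    · have h' := hNt h
      exact ⟨q.1, Or.inl rfl, fun l y => ⟨fun h'' => hold h'' h', fun h'' => hold h'' h'⟩⟩
    · have h' := hNt h
      exact ⟨q.2, Or.inr rfl, fun l y => ⟨fun h'' => hold h'' h', fun h'' => hold h'' h'⟩⟩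
  obtain ⟨s', h, h'⟩ := s.exists_extend hcommute l N
    (((Set.finite_singleton (a.flip, x.flip)).insert (a, x)).subset (by
      rintro ⟨u, w⟩ (⟨h, h'⟩ | ⟨-, h, h'⟩)
      exacts [Or.inl (Prod.ext h h'), Or.inr (Prod.ext h h')])) M (fun _ _ => Iff.rfl) (by
    rintro u w w' (h | h) (h' | h')
    · exact s.functional h h'
    · exact absurd h (hNs h' _)
    · exact absurd h' (hNs h _)
    · rcases h with ⟨h1, h2⟩ | ⟨-, h1, h2⟩ <;> rcases h' with ⟨h3, h4⟩ | ⟨-, h3, h4⟩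
      exacts [h2.trans h4.symm, absurd (h1.symm.trans h3) (Pt.ne_flip a),
        absurd (h1.symm.trans h3) (Pt.flip_ne a), h2.trans h4.symm]) hinj (by
    rintro u w hl (⟨rfl, rfl⟩ | ⟨-, rfl, rfl⟩)
    · exact Or.inr ⟨hl, rfl, rfl⟩
    · exact Or.inl ⟨by simp, by simp⟩) A (fun _ _ => Iff.rfl) (by
    rintro p q p' q' hA hA' hpq'
    obtain ⟨-, -, h1, h2, -⟩ := hA
    have h3 := hfree hA' hpq'.symm
    obtain ⟨-, -, -, -, h4⟩ := hA'
    have h5 : p.1.1 = q'.1.1 ∧ p.2.1 = q'.2.1 := by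
      rcases h3 with rfl | rfl <;> exact ⟨rfl, rfl⟩
    rcases h4 with h4 | h4
    · exact hMs h1 (h5.1.trans (hNt h4))
    · exact hMs h2 (h5.2.trans (hNt h4))) (by
    rintro p q p' q' hA hA' hqq'
    have h3 := hfree hA hqq'
    obtain ⟨-, -, h1, h2, h0⟩ := hA
    obtain ⟨-, -, h1', h2', -⟩ := hA'
    rcases h3 with rfl | rfl
    · exact Or.inl ⟨Prod.ext (hinj h1' h1) (hinj h2' h2), rfl⟩
    · by_cases hl : comm l.1
      · exact Or.inr ⟨hl, Prod.ext (hinj h1' (hMf hl h1)) (hinj h2' (hMf hl h2)), rfl⟩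
      -- When the letter need not commute with t, `x.flip` is not a value of the letter, so only one
      -- of `q` and `flipPair q` can be a target.
      · have hMx : ∀ u, ¬ M u x.flip := by
          rintro u (h | ⟨-, h⟩ | ⟨h, -⟩)
          exacts [hx x.flip rfl _ _ h, Pt.flip_ne _ h, hl h]
        rcases h0 with (⟨-, h0⟩ | ⟨h0, -⟩) | (⟨-, h0⟩ | ⟨h0, -⟩)
        · exact absurd (by simpa [flipPair, h0] using h1') (hMx p'.1)
        · exact absurd h0 hl
        · exact absurd (by simpa [flipPair, h0] using h2') (hMx p'.2)
        · exact absurd h0 hl)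
  exact ⟨s', h, x, h' _ _ (Or.inl ⟨rfl, rfl⟩)⟩

/-- Use an unused generator to connect a pair to the pair of `o` and its image under the
involution. -/
theorem exists_connected_of_unused (s : PartialAction gen t comm)
    (hcommute : ∀ i, comm i → Commute (gen i) t) {i : S} (hi : ∀ b x y, ¬ s.edge (i, b) x y)
    {o x y : Pt} (hxy : x ≠ y) (hcomm : comm i → y = x.flip)
    (ho : ¬ Connected (pairStep gen t s.edge) (o, o.flip) (x, y))
    (hsw : ¬ comm i → ¬ Connected (pairStep gen t s.edge) (x, y) (y, x)) :
    ∃ s', s ≤ s' ∧ Connected (pairStep gen t s'.edge) (o, o.flip) (x, y) := by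
  let N : Pt → Pt → Prop := fun u w => (u = o ∧ w = x) ∨ (u = o.flip ∧ w = y)
  let A : Pt × Pt → Pt × Pt → Prop := fun p q =>
    p.1 ≠ p.2 ∧ q.1 ≠ q.2 ∧ N p.1 q.1 ∧ N p.2 q.2 ∧ (N p.1 q.1 ∨ N p.2 q.2)
  have hA : ∀ p q, A p q → (p = (o, o.flip) ∧ q = (x, y)) ∨ (p = (o.flip, o) ∧ q = (y, x)) := by
    rintro ⟨p1, p2⟩ ⟨q1, q2⟩ ⟨h1, h2, ⟨h3, h3'⟩ | ⟨h3, h3'⟩, ⟨h4, h4'⟩ | ⟨h4, h4'⟩, -⟩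
    · exact absurd (h3.trans h4.symm) h1
    · exact Or.inl ⟨Prod.ext h3 h4, Prod.ext h3' h4'⟩
    · exact Or.inr ⟨Prod.ext h3 h4, Prod.ext h3' h4'⟩
    · exact absurd (h3.trans h4.symm) h1
  -- Both new edges start in one component, as t reverses this pair; hence `ho` separates all
  -- sources from all targets.
  have hoo : Connected (pairStep gen t s.edge) (o, o.flip) (o.flip, o) := by
    simpa [flipPair] using connected_flipPair (gen := gen) (t := t) (edge := s.edge)
      (p := (o, o.flip)) (Pt.ne_flip o)
  have hswap : ∀ p q, Connected (pairStep gen t s.edge) p q →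
      Connected (pairStep gen t s.edge) p.swap q.swap := fun p q h =>
    h.map fun g p q => pairStep_swap g p q
  obtain ⟨s', h, h'⟩ := s.exists_extend hcommute (i, true) N
    (((Set.finite_singleton (o.flip, y)).insert (o, x)).subset (by
      rintro ⟨u, w⟩ (⟨h, h'⟩ | ⟨h, h'⟩)
      exacts [Or.inl (Prod.ext h h'), Or.inr (Prod.ext h h')])) N (fun u w => by simp [hi]) (by
    rintro u w w' (⟨h1, h2⟩ | ⟨h1, h2⟩) (⟨h3, h4⟩ | ⟨h3, h4⟩)
    exacts [h2.trans h4.symm, absurd (h1.symm.trans h3) (Pt.ne_flip o),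
      absurd (h1.symm.trans h3) (Pt.flip_ne o), h2.trans h4.symm]) (by
    rintro u w w' (⟨h1, h2⟩ | ⟨h1, h2⟩) (⟨h3, h4⟩ | ⟨h3, h4⟩)
    exacts [h1.trans h3.symm, absurd (h2.symm.trans h4) hxy,
      absurd (h4.symm.trans h2) hxy, h1.trans h3.symm]) (by
    rintro u w hl (⟨rfl, rfl⟩ | ⟨rfl, rfl⟩)
    · exact Or.inr ⟨rfl, (hcomm hl).symm⟩
    · exact Or.inl ⟨by simp, by simp [hcomm hl]⟩) A (fun _ _ => Iff.rfl) (by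
    intro p q p' q' h h' hc
    rcases hA _ _ h with ⟨rfl, rfl⟩ | ⟨rfl, rfl⟩ <;> rcases hA _ _ h' with ⟨rfl, rfl⟩ | ⟨rfl, rfl⟩
    · exact ho hc
    · exact ho (hoo.trans (hswap _ _ hc))
    · exact ho (hoo.trans hc)
    · exact ho (hswap _ _ hc)) (by
    intro p q p' q' h h' hc
    rcases hA _ _ h with ⟨rfl, rfl⟩ | ⟨rfl, rfl⟩ <;> rcases hA _ _ h' with ⟨rfl, rfl⟩ | ⟨rfl, rfl⟩
    · exact Or.inl ⟨rfl, rfl⟩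
    -- The two targets (x, y) and (y, x) can share a component only when the generator commutes with
    -- t, and then the two edges are images of each other under t.
    · have hci : comm i := by_contra fun hci => hsw hci hc
      exact Or.inr ⟨hci, by simp [flipPair], by simp [flipPair, hcomm hci]⟩
    · have hci : comm i := by_contra fun hci => hsw hci hc.symm
      exact Or.inr ⟨hci, by simp [flipPair], by simp [flipPair, hcomm hci]⟩
    · exact Or.inl ⟨rfl, rfl⟩)
  exact ⟨s', h, Connected.of_step (g := letterVal gen (i, true)) ⟨Pt.ne_flip o, hxy, Or.inr
    ⟨_, rfl, h' _ _ (Or.inl ⟨rfl, rfl⟩), h' _ _ (Or.inr ⟨rfl, rfl⟩)⟩⟩⟩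

theorem exists_unused (s : PartialAction gen t comm) {I : Set S} (hI : I.Infinite) :
    ∃ i ∈ I, ∀ b x y, ¬ s.edge (i, b) x y := by
  obtain ⟨i, hi, hi'⟩ := hI.exists_notMem_finite (s.finite.image fun e => e.1.1)
  exact ⟨i, hi, fun b x y h => hi' ⟨((i, b), x, y), h, rfl⟩⟩

/-- Every partial action extends to one in which two given pairs, the first of them reversed by the
involution, are connected. -/
theorem exists_connected (s : PartialAction gen t comm)
    (hcommute : ∀ i, comm i → Commute (gen i) t)
    (hinf : {i | comm i}.Infinite) (hinf' : {i | ¬ comm i}.Infinite)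
    (o : Pt) {x y : Pt} (hxy : x ≠ y) :
    ∃ s', s ≤ s' ∧ Connected (pairStep gen t s'.edge) (o, o.flip) (x, y) := by
  by_cases ho : Connected (pairStep gen t s.edge) (o, o.flip) (x, y)
  · exact ⟨s, le_rfl, ho⟩
  -- If (x, y) is already reversed by some element, a free generator would bring in the conjugate of
  -- t as a second one and destroy freeness. A commuting generator conjugates t to itself.
  by_cases hsw : Connected (pairStep gen t s.edge) (x, y) (y, x)
  · obtain ⟨b, hb⟩ := s.diag (x, y) hxy hsw
    obtain ⟨i, hi, hi'⟩ := s.exists_unused hinf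
    obtain ⟨s', hs', h⟩ := s.exists_connected_of_unused hcommute hi' (Pt.ne_flip b)
      (fun _ => rfl) (fun h => ho (h.trans hb.symm)) (fun h => absurd hi h)
    exact ⟨s', hs', h.trans (hb.mono (pairStep_mono hs')).symm⟩
  · obtain ⟨i, hi, hi'⟩ := s.exists_unused hinf'
    exact s.exists_connected_of_unused hcommute hi' hxy (fun h => absurd h hi) ho fun _ => hsw

/-- The partial action in which only the involution is defined. -/
theorem nonempty (ht : t * t = 1) : Nonempty (PartialAction gen t comm) := by
  refine ⟨⟨fun _ _ _ => False, by simp, by simp, by simp, by simp,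
    -- The only edges come from t, which toggles the Boolean of the first point; t² = 1 makes this
    -- consistent in both directions.
    ⟨fun p => if p.1.2 then t else 1, ?_⟩, ?_⟩⟩
  · rintro g p q ⟨-, -, ⟨rfl, rfl⟩ | ⟨l, -, h, -⟩⟩
    · rcases h : p.1.2 <;> simp [flipPair, Pt.flip, h, ht]
    · exact h.elim
  · intro p hp hpp
    have := hpp.apply_eq (F := fun p => p.1.1) fun g p q hs => by
      obtain ⟨-, -, ⟨-, rfl⟩ | ⟨l, -, h, -⟩⟩ := hs
      · rfl
      · exact h.elim
    obtain ⟨⟨m, b⟩, ⟨m', b'⟩⟩ := p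
    obtain rfl : m = m' := this
    have : b' = !b := by
      cases b <;> cases b' <;> simp_all
    subst this
    exact ⟨(m, b), Connected.refl _⟩

end PartialAction

end

-- Generators, homomorphisms and functoriality of the free product.

universe w

/-- The homomorphism from `ℤ/2ℤ` given by an element whose square is trivial. -/
def zmodTwoHom {G : Type*} [Group G] (t : G) (ht : t * t = 1) : Multiplicative (ZMod 2) →* G :=
  AddMonoidHom.toMultiplicativeLeft
    (ZMod.lift 2 ⟨zmultiplesHom (Additive G) (Additive.ofMul t), by
      change Additive.ofMul (t ^ (2 : ℤ)) = 0
      rw [zpow_two, ht, ofMul_one]⟩)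

@[simp] theorem zmodTwoHom_ofAdd_one {G : Type*} [Group G] (t : G) (ht : t * t = 1) :
    zmodTwoHom t ht (Multiplicative.ofAdd 1) = t := by
  have h : ((1 : ℤ) : ZMod 2) = 1 := by norm_num
  change Additive.toMul (ZMod.lift 2 _ (1 : ZMod 2)) = t
  rw [← h, ZMod.lift_coe]
  simp

theorem multiplicative_zmodTwo_cases (z : Multiplicative (ZMod 2)) :
    z = 1 ∨ z = Multiplicative.ofAdd 1 := by
  revert z
  decide

theorem commute_freeGroupLift {α : Type*} {G : Type*} [Group G] {f : α → G} {t : G}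
    (hf : ∀ i, Commute (f i) t) (x : FreeGroup α) : Commute (FreeGroup.lift f x) t := by
  have h : (⊤ : Subgroup (FreeGroup α)) ≤ (Subgroup.centralizer {t}).comap (FreeGroup.lift f) := by
    rw [← FreeGroup.closure_range_of, Subgroup.closure_le]
    rintro _ ⟨i, rfl⟩
    simpa [Subgroup.mem_centralizer_singleton_iff] using (hf i).eq
  exact Subgroup.mem_centralizer_singleton_iff.1 (h (Subgroup.mem_top x))

theorem commute_zmodTwoHom {G : Type*} [Group G] {a t : G} (ht : t * t = 1)
    (h : Commute a t) (z : Multiplicative (ZMod 2)) : Commute a (zmodTwoHom t ht z) := by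
  rcases multiplicative_zmodTwo_cases z with rfl | rfl
  · simp
  · simpa using h

/-- The homomorphism from the product of a free group and `ℤ/2ℤ` given by the images of the
generators. -/
def freeProdZModTwoLift {α : Type*} {G : Type*} [Group G] (t : G) (ht : t * t = 1) (f : α → G)
    (hf : ∀ i, Commute (f i) t) : FreeGroup α × Multiplicative (ZMod 2) →* G :=
  (FreeGroup.lift f).noncommCoprod (zmodTwoHom t ht) fun x z =>
    commute_zmodTwoHom ht (commute_freeGroupLift hf x) z

namespace FreeProdGroup

variable {α : Type w}

/-- The generator of the factor `ℤ/2ℤ`. -/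
def invol : FreeProdGroup α := Monoid.Coprod.inl (1, Multiplicative.ofAdd 1)

/-- The generators of the free factor that commutes with the involution. -/
def comGen (i : α) : FreeProdGroup α := Monoid.Coprod.inl (FreeGroup.of i, 1)

/-- The generators of the second free factor. -/
def freeGen (i : α) : FreeProdGroup α := Monoid.Coprod.inr (FreeGroup.of i)

theorem invol_mul_invol : (invol : FreeProdGroup α) * invol = 1 := by
  rw [invol, ← map_mul]
  have h : ((1, Multiplicative.ofAdd 1) * (1, Multiplicative.ofAdd 1) :
      FreeGroup α × Multiplicative (ZMod 2)) = 1 := by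
    exact Prod.ext (mul_one _) (by decide :
      (Multiplicative.ofAdd 1 * Multiplicative.ofAdd 1 : Multiplicative (ZMod 2)) = 1)
  rw [h, map_one]

theorem commute_comGen (i : α) : Commute (comGen i) invol := by
  rw [comGen, invol, Commute, SemiconjBy, ← map_mul, ← map_mul]
  simp

theorem subgroup_eq_top {K : Subgroup (FreeProdGroup α)} (h : invol ∈ K) (h₁ : ∀ i, comGen i ∈ K)
    (h₂ : ∀ i, freeGen i ∈ K) : K = ⊤ := by
  have key : ∀ φ : FreeGroup α →* FreeProdGroup α, (∀ i, φ (FreeGroup.of i) ∈ K) → ∀ x, φ x ∈ K := by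
    intro φ hφ x
    have h : (⊤ : Subgroup (FreeGroup α)) ≤ K.comap φ := by
      rw [← FreeGroup.closure_range_of, Subgroup.closure_le]
      rintro _ ⟨i, rfl⟩
      exact hφ i
    exact h (Subgroup.mem_top x)
  rw [eq_top_iff]
  rintro x -
  induction x using Monoid.Coprod.induction_on with
  | inl m =>
    obtain ⟨x, z⟩ := m
    have hx := key (Monoid.Coprod.inl.comp (MonoidHom.inl _ _)) h₁ x
    have hz : (Monoid.Coprod.inl (1, z) : FreeProdGroup α) ∈ K := by
      rcases multiplicative_zmodTwo_cases z with rfl | rfl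
      · change (Monoid.Coprod.inl 1 : FreeProdGroup α) ∈ K
        rw [map_one]
        exact K.one_mem
      · exact h
    have := K.mul_mem hx hz
    simpa [← map_mul] using this
  | inr x => exact key Monoid.Coprod.inr h₂ x
  | mul x y hx hy => exact K.mul_mem hx hy

theorem hom_ext {G : Type*} [Group G] {φ ψ : FreeProdGroup α →* G} (h : φ invol = ψ invol)
    (h₁ : ∀ i, φ (comGen i) = ψ (comGen i)) (h₂ : ∀ i, φ (freeGen i) = ψ (freeGen i)) : φ = ψ := by
  have hK : φ.eqLocus ψ = ⊤ := subgroup_eq_top h h₁ h₂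
  exact MonoidHom.ext fun x => (hK ▸ Subgroup.mem_top x : x ∈ φ.eqLocus ψ)

/-- The homomorphism given by the images of the generators. -/
def lift {G : Type*} [Group G] (t : G) (ht : t * t = 1) (f : α → G) (hf : ∀ i, Commute (f i) t)
    (g : α → G) : FreeProdGroup α →* G :=
  Monoid.Coprod.lift (freeProdZModTwoLift t ht f hf) (FreeGroup.lift g)

section

variable {G : Type*} [Group G] (t : G) (ht : t * t = 1) (f : α → G) (hf : ∀ i, Commute (f i) t)
  (g : α → G)

@[simp] theorem lift_invol : lift t ht f hf g invol = t := by
  simp [lift, invol, freeProdZModTwoLift]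

@[simp] theorem lift_comGen (i : α) : lift t ht f hf g (comGen i) = f i := by
  simp [lift, comGen, freeProdZModTwoLift]

@[simp] theorem lift_freeGen (i : α) : lift t ht f hf g (freeGen i) = g i := by
  simp [lift, freeGen]

end

/-- The homomorphism induced by a map of index sets. -/
def map {β : Type*} (φ : α → β) : FreeProdGroup α →* FreeProdGroup β :=
  lift invol invol_mul_invol (fun i => comGen (φ i)) (fun _ => commute_comGen _)
    fun i => freeGen (φ i)

theorem map_map {β γ : Type*} (φ : α → β) (ψ : β → γ) (x : FreeProdGroup α) :
    map ψ (map φ x) = map (ψ ∘ φ) x := by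
  have : (map ψ).comp (map φ) = map (ψ ∘ φ) := hom_ext (by simp [map]) (by simp [map])
    (by simp [map])
  exact DFunLike.congr_fun this x

theorem map_id (x : FreeProdGroup α) : map (id : α → α) x = x := by
  have : map (id : α → α) = MonoidHom.id _ := hom_ext (by simp [map]) (by simp [map])
    (by simp [map])
  exact DFunLike.congr_fun this x

theorem map_injective {β : Type*} [Nonempty α] {φ : α → β} (hφ : Function.Injective φ) :
    Function.Injective (map φ) := by
  refine Function.LeftInverse.injective (g := map (Function.invFun φ)) fun x => ?_
  rw [map_map, Function.invFun_comp hφ, map_id]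

/-- The generators other than the involution. -/
def gen : α ⊕ α → FreeProdGroup α := Sum.elim comGen freeGen

end FreeProdGroup

/-! ### The limit action, regular on pairs of distinct points. -/

open FreeProdGroup in
/-- The free product acts on a countable set such that the action on ordered pairs of distinct
points is regular. -/
theorem exists_regular_on_pairs : ∃ Φ : FreeProdGroup ℕ →* Equiv.Perm Pt,
    (∀ x, Φ invol x = x.flip) ∧
    (∀ g x y, x ≠ y → Φ g x = x → Φ g y = y → g = 1) ∧
    ∀ x y x' y', x ≠ y → x' ≠ y' → ∃ g, Φ g x = x' ∧ Φ g y = y' := by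
  let comm : ℕ ⊕ ℕ → Prop := fun i => i.isLeft
  have hcommute : ∀ i, comm i → Commute (gen i) (invol : FreeProdGroup ℕ) := by
    rintro (i | i) hi
    · exact commute_comGen i
    · simp [comm] at hi
  have hinf : {i | comm i}.Infinite :=
    Set.infinite_of_injective_forall_mem (f := Sum.inl) Sum.inl_injective fun i => rfl
  have hinf' : {i | ¬ comm i}.Infinite :=
    Set.infinite_of_injective_forall_mem (f := Sum.inr) Sum.inr_injective fun i => by simp [comm]
  let P := PartialAction (gen : ℕ ⊕ ℕ → FreeProdGroup ℕ) invol comm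
  obtain ⟨s₀⟩ : Nonempty P := PartialAction.nonempty invol_mul_invol
  let o : Pt := (0, false)
  -- Countably many requirements: each letter is defined at each point, and each pair of distinct
  -- points is connected to (o, t o). An increasing sequence meets them all.
  let 𝒟 : ((ℕ ⊕ ℕ) × Bool) × Pt ⊕ Pt × Pt → Order.Cofinal P := Sum.elim
    (fun e => ⟨{s | ∃ y, s.edge e.1 e.2 y}, fun s => by
      obtain ⟨s', h, h'⟩ := s.exists_edge hcommute e.1 e.2
      exact ⟨s', h', h⟩⟩)
    (fun e => ⟨{s | e.1 ≠ e.2 → Connected (pairStep gen invol s.edge) (o, o.flip) e}, fun s => by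
      by_cases he : e.1 = e.2
      · exact ⟨s, fun h => absurd he h, le_rfl⟩
      · obtain ⟨s', h, h'⟩ := s.exists_connected hcommute hinf hinf' o he
        exact ⟨s', fun _ => h', h⟩⟩)
  let s := Order.sequenceOfCofinals s₀ 𝒟
  have hmono : Monotone s := Order.sequenceOfCofinals.monotone s₀ 𝒟
  have htot : ∀ l x, ∃ y n, (s n).edge l x y := fun l x => by
    obtain ⟨y, hy⟩ := Order.sequenceOfCofinals.encode_mem s₀ 𝒟 (Sum.inl (l, x))
    exact ⟨y, _, hy⟩
  have hconn : ∀ e : Pt × Pt, e.1 ≠ e.2 →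
      ∃ n, Connected (pairStep gen invol (s n).edge) (o, o.flip) e := fun e he =>
    ⟨_, Order.sequenceOfCofinals.encode_mem s₀ 𝒟 (Sum.inr e) he⟩
  have hfun : ∀ {l x y y' n n'}, (s n).edge l x y → (s n').edge l x y' → y = y' :=
    fun {l x y y' n n'} h h' => (s (max n n')).functional
      (hmono (le_max_left _ _) _ _ _ h) (hmono (le_max_right _ _) _ _ _ h')
  choose φ hφ using htot
  choose N hN using hφ
  have hφ_eq : ∀ {n l x y}, (s n).edge l x y → φ l x = y := fun h => hfun (hN _ _) h
  have hinv : ∀ l x, φ (letterInv l) (φ l x) = x := fun l x => hφ_eq ((s _).symm (hN l x))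
  let π : ℕ ⊕ ℕ → Equiv.Perm Pt := fun i =>
    ⟨φ (i, true), φ (i, false), hinv (i, true), hinv (i, false)⟩
  let τ : Equiv.Perm Pt := ⟨Pt.flip, Pt.flip, Pt.flip_flip, Pt.flip_flip⟩
  have hτ : τ * τ = 1 := Equiv.ext fun x => Pt.flip_flip x
  let Φ : FreeProdGroup ℕ →* Equiv.Perm Pt := lift τ hτ (fun i => π (Sum.inl i))
    (fun i => Equiv.ext fun x => hφ_eq ((s _).flip rfl (hN _ x))) fun i => π (Sum.inr i)
  have hΦinvol : ∀ x, Φ invol x = x.flip := fun x =>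
    DFunLike.congr_fun (lift_invol τ hτ _ _ _ : Φ invol = τ) x
  have hΦgen : ∀ i x, Φ (gen i) x = φ (i, true) x := by
    rintro (i | i) x
    · exact DFunLike.congr_fun (lift_comGen τ hτ _ _ _ i : Φ (comGen i) = π (Sum.inl i)) x
    · exact DFunLike.congr_fun (lift_freeGen τ hτ _ _ _ i : Φ (freeGen i) = π (Sum.inr i)) x
  have hΦletter : ∀ l x, Φ (letterVal gen l) x = φ l x := by
    rintro ⟨i, _ | _⟩ x
    · simp only [letterVal, Bool.false_eq_true, if_false, map_inv]
      rw [Equiv.Perm.inv_eq_iff_eq, hΦgen]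
      exact (hinv (i, false) x).symm
    · simp [letterVal, hΦgen]
  have hne : ∀ g x y, x ≠ y → Φ g x ≠ Φ g y := fun g x y h h' => h ((Φ g).injective h')
  refine ⟨Φ, hΦinvol, ?_, ?_⟩
  · choose c hc using fun n => (s n).potential
    -- Potentials of different stages are unrelated, so the identity is demanded only at all
    -- sufficiently late stages, depending on the pair. An element fixing the pair is then trivial
    -- by cancellation.
    let K : Subgroup (FreeProdGroup ℕ) :=
      { carrier := {g | ∀ x y, x ≠ y → ∃ n, ∀ m ≥ n, c m (Φ g x, Φ g y) = g * c m (x, y)}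
        one_mem' := fun x y _ => ⟨0, fun m _ => by simp⟩
        mul_mem' := fun {g h} hg hh x y hxy => by
          obtain ⟨n, hn⟩ := hh x y hxy
          obtain ⟨n', hn'⟩ := hg _ _ (hne h x y hxy)
          refine ⟨max n n', fun m hm => ?_⟩
          rw [map_mul, Equiv.Perm.mul_apply, Equiv.Perm.mul_apply,
            hn' m (le_trans (le_max_right _ _) hm), hn m (le_trans (le_max_left _ _) hm),
            mul_assoc]
        inv_mem' := fun {g} hg x y hxy => by
          obtain ⟨n, hn⟩ := hg _ _ (hne g⁻¹ x y hxy)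
          refine ⟨n, fun m hm => ?_⟩
          have e : ∀ z, Φ g (Φ g⁻¹ z) = z := fun z => by
            rw [← Equiv.Perm.mul_apply, ← map_mul, mul_inv_cancel, map_one, Equiv.Perm.one_apply]
          have := hn m hm
          rw [e, e] at this
          rw [this, inv_mul_cancel_left] }
    have hgen : ∀ i, gen i ∈ K := fun i x y hxy => by
      refine ⟨max (N (i, true) x) (N (i, true) y), fun m hm => ?_⟩
      have e : ∀ z, N (i, true) z ≤ m → (s m).edge (i, true) z (Φ (gen i) z) := fun z hz => by
        rw [hΦgen]
        exact hmono hz _ _ _ (hN _ z)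
      exact hc m _ _ _ ⟨hxy, hne _ _ _ hxy, Or.inr ⟨(i, true), rfl,
        e x (le_trans (le_max_left _ _) hm), e y (le_trans (le_max_right _ _) hm)⟩⟩
    have hK : K = ⊤ := subgroup_eq_top
      (fun x y hxy => ⟨0, fun m _ => hc m _ _ _ ⟨hxy, hne _ _ _ hxy, Or.inl ⟨rfl, by
        simp [hΦinvol, flipPair]⟩⟩⟩) (fun i => hgen (Sum.inl i)) fun i => hgen (Sum.inr i)
    intro g x y hxy hx hy
    obtain ⟨n, hn⟩ := (hK ▸ Subgroup.mem_top g : g ∈ K) x y hxy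
    have := hn n le_rfl
    rw [hx, hy] at this
    exact (mul_eq_right.1 this.symm)
  · have horb : ∀ n p q, Connected (pairStep gen invol (s n).edge) p q →
        ∃ g, Φ g p.1 = q.1 ∧ Φ g p.2 = q.2 := by
      intro n p q h
      induction h with
      | rel p q h =>
        obtain ⟨g, -, -, ⟨rfl, rfl⟩ | ⟨l, rfl, h1, h2⟩⟩ := h
        · exact ⟨invol, hΦinvol _, hΦinvol _⟩
        · exact ⟨_, (hΦletter l _).trans (hφ_eq h1), (hΦletter l _).trans (hφ_eq h2)⟩
      | refl p => exact ⟨1, by simp⟩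
      | symm p q _ ih =>
        obtain ⟨g, h1, h2⟩ := ih
        exact ⟨g⁻¹, by simp [← h1], by simp [← h2]⟩
      | trans p q r _ _ ih₁ ih₂ =>
        obtain ⟨g, h1, h2⟩ := ih₁
        obtain ⟨h, h3, h4⟩ := ih₂
        exact ⟨h * g, by simp [h1, h3], by simp [h2, h4]⟩
    intro x y x' y' h h'
    obtain ⟨n, hn⟩ := hconn (x, y) h
    obtain ⟨n', hn'⟩ := hconn (x', y') h'
    obtain ⟨g, h1, h2⟩ : ∃ g, Φ g x = o ∧ Φ g y = o.flip := horb _ _ _ hn.symm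
    obtain ⟨g', h3, h4⟩ : ∃ g, Φ g o = x' ∧ Φ g o.flip = y' := horb _ _ _ hn'
    exact ⟨g' * g, by rw [map_mul, Equiv.Perm.mul_apply, h1, h3],
      by rw [map_mul, Equiv.Perm.mul_apply, h2, h4]⟩

/-! ### Sharp 2-transitivity and non-splitness of the infinite rank group. -/

theorem IsSharplyTransitiveGroup.of_mulEquiv {n : ℕ} {G H : Type u} [Group G] [Group H]
    (e : H ≃* G) (h : IsSharplyTransitiveGroup n G) : IsSharplyTransitiveGroup n H := by
  obtain ⟨X, hX, hne, hX'⟩ := h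
  refine ⟨X, MulAction.compHom X e.toMonoidHom, hne, fun x y => ?_⟩
  obtain ⟨g, hg, hg'⟩ := hX' x y
  refine ⟨e.symm g, fun i => ?_, fun h hh => ?_⟩
  · change e (e.symm g) • x i = y i
    rw [e.apply_symm_apply, hg]
  · rw [← hg' (e h) hh, e.symm_apply_apply]

theorem IsSplitGroup.of_mulEquiv {G H : Type u} [Group G] [Group H]
    (e : H ≃* G) (h : IsSplitGroup H) : IsSplitGroup G := by
  obtain ⟨N, hN, hN', hab⟩ := h
  refine ⟨N.map e.toMonoidHom, ?_, hN'.map _ e.surjective, ?_⟩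
  · rwa [Ne, Subgroup.map_eq_bot_iff_of_injective _ e.injective]
  · rintro _ ⟨a, ha, rfl⟩ _ ⟨b, hb, rfl⟩
    rw [← map_mul, ← map_mul, hab a ha b hb]

open FreeProdGroup

theorem isSharplyTransitiveGroup_freeProdGroup : IsSharplyTransitiveGroup 2 (FreeProdGroup ℕ) := by
  obtain ⟨Φ, -, hfree, htrans⟩ := exists_regular_on_pairs
  refine ⟨Pt, MulAction.compHom Pt Φ, ⟨⟨fun i => (i, true), fun i j h => ?_⟩⟩, fun x y => ?_⟩
  · exact Fin.ext (congrArg Prod.fst h)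
  · obtain ⟨g, h0, h1⟩ := htrans (x 0) (x 1) (y 0) (y 1)
      (fun h => Fin.zero_ne_one (x.injective h)) fun h => Fin.zero_ne_one (y.injective h)
    refine ⟨g, fun i => ?_, fun h hh => ?_⟩
    · fin_cases i
      exacts [h0, h1]
    · have hh' : ∀ i, Φ h (x i) = y i := hh
      have := hfree (g⁻¹ * h) (x 0) (x 1) (fun h => Fin.zero_ne_one (x.injective h))
        (by rw [map_mul, Equiv.Perm.mul_apply, hh', map_inv, Equiv.Perm.inv_eq_iff_eq, h0])
        (by rw [map_mul, Equiv.Perm.mul_apply, hh', map_inv, Equiv.Perm.inv_eq_iff_eq, h1])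
      exact (inv_mul_eq_one.1 this).symm

/-- The involution does not commute with all its conjugates. -/
theorem not_commute_conj_invol {α : Type*} (i : α) :
    ¬ Commute (freeGen i * invol * (freeGen i)⁻¹) (invol : FreeProdGroup α) := by
  intro h
  -- In the quotient S₃ the two elements become the transpositions (0 2) and (0 1).
  let τ : Equiv.Perm (Fin 3) := Equiv.swap 0 1
  have := h.map (lift τ (by decide) (fun _ => 1) (fun _ => Commute.one_left _)
    fun _ => Equiv.swap 1 2)
  simp only [map_mul, map_inv, lift_invol, lift_freeGen, τ] at this
  revert this
  unfold Commute SemiconjBy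
  decide

theorem not_isSplitGroup_freeProdGroup : ¬ IsSplitGroup (FreeProdGroup ℕ) := by
  obtain ⟨Φ, hinvol, hfree, htrans⟩ := exists_regular_on_pairs
  rintro ⟨N, hN, hnormal, hab⟩
  have hΦinj : ∀ g, (∀ x, Φ g x = x) → g = 1 := fun g h =>
    hfree g _ _ (Pt.ne_flip (0, true)) (h _) (h _)
  -- By 2-transitivity, a non-trivial element of `N` has a conjugate that moves any given point to
  -- any other.
  have hNtrans : ∀ x y : Pt, ∃ n ∈ N, Φ n x = y := by
    intro x y
    by_cases hxy : x = y
    · exact ⟨1, N.one_mem, by simp [hxy]⟩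
    obtain ⟨n, hn, hn1⟩ := N.bot_or_exists_ne_one.resolve_left hN
    obtain ⟨z, hz⟩ : ∃ z, Φ n z ≠ z := by
      by_contra! h
      exact hn1 (hΦinj n h)
    obtain ⟨g, h1, h2⟩ := htrans z (Φ n z) x y hz.symm hxy
    refine ⟨g * n * g⁻¹, hnormal.conj_mem n hn g, ?_⟩
    have : Φ g⁻¹ x = z := by rw [map_inv, Equiv.Perm.inv_eq_iff_eq, h1]
    rw [map_mul, map_mul, Equiv.Perm.mul_apply, Equiv.Perm.mul_apply, this, h2]
  -- A transitive abelian group acts regularly.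
  have hNreg : ∀ n ∈ N, ∀ x, Φ n x = x → n = 1 := by
    refine fun n hn x hx => hΦinj n fun y => ?_
    obtain ⟨m, hm, rfl⟩ := hNtrans x y
    rw [← Equiv.Perm.mul_apply, ← map_mul, hab n hn m hm, map_mul, Equiv.Perm.mul_apply, hx]
  -- an involution is conjugate to the standard one, so it has no fixed points
  have hfix : ∀ j, j * j = 1 → ∀ x, Φ j x = x → j = 1 := by
    intro j hj x hx
    by_contra hj1
    obtain ⟨y, hy⟩ : ∃ y, Φ j y ≠ y := by
      by_contra! h
      exact hj1 (hΦinj j h)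
    have hjj : Φ j (Φ j y) = y := by
      rw [← Equiv.Perm.mul_apply, ← map_mul, hj, map_one, Equiv.Perm.one_apply]
    -- This conjugate of t exchanges `y` and `Φ j y`, as `j` does, so the two agree by freeness on
    -- pairs.
    obtain ⟨g, h1, h2⟩ := htrans y (Φ j y) y.flip y hy.symm (Pt.flip_ne y)
    have hg1 : Φ g⁻¹ y.flip = y := by rw [map_inv, Equiv.Perm.inv_eq_iff_eq, h1]
    have hg2 : Φ g⁻¹ y = Φ j y := by rw [map_inv, Equiv.Perm.inv_eq_iff_eq, h2]
    have key : j * (g⁻¹ * invol * g) = 1 := by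
      refine hfree _ y (Φ j y) hy.symm ?_ ?_
      · simp only [map_mul, Equiv.Perm.mul_apply, h1, hinvol, Pt.flip_flip, hg2, hjj]
      · simp only [map_mul, Equiv.Perm.mul_apply, h2, hinvol, hg1]
    have hjt : j = g⁻¹ * invol * g := by
      rw [eq_inv_of_mul_eq_one_left key]
      simp [mul_assoc, inv_eq_of_mul_eq_one_left (invol_mul_invol (α := ℕ))]
    rw [hjt] at hx
    simp only [map_mul, Equiv.Perm.mul_apply, hinvol] at hx
    rw [map_inv, Equiv.Perm.inv_eq_iff_eq] at hx
    exact Pt.flip_ne _ hx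
  -- Take n in `N` agreeing with t at a point. Then t n fixes that point, and its square (t n t) n
  -- lies in `N` and fixes it too, so it is trivial. By `hfix`, t n = 1.
  have htN : invol ∈ N := by
    obtain ⟨n, hn, hnx⟩ := hNtrans (0, true) (Pt.flip (0, true))
    have hnormal' : invol * n * invol ∈ N := by
      have := hnormal.conj_mem n hn invol
      rwa [inv_eq_of_mul_eq_one_left (invol_mul_invol (α := ℕ))] at this
    have h1 : (invol * n) * (invol * n) = 1 := by
      rw [← mul_assoc]
      refine hNreg _ (N.mul_mem hnormal' hn) (0, true) ?_
      simp only [map_mul, Equiv.Perm.mul_apply, hnx, hinvol, Pt.flip_flip]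
    have h2 := hfix _ h1 (0, true) (by
      simp only [map_mul, Equiv.Perm.mul_apply, hnx, hinvol, Pt.flip_flip])
    rw [eq_inv_of_mul_eq_one_left h2]
    exact N.inv_mem hn
  exact not_commute_conj_invol 0 (hab _ (hnormal.conj_mem _ htN (freeGen 0)) _ htN)

/-! ### Embedding infinite rank into finite rank by conjugation. -/

namespace FreeProdGroup

/-- The left regular representation. -/
def leftMul : FreeProdGroup ℤ →* Equiv.Perm (FreeProdGroup ℤ) := MulAction.toPermHom _ _

theorem leftMul_injective : Function.Injective leftMul := MulAction.toPerm_injective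

theorem map_eq_self {α : Type*} {φ : α → α} (h : ∀ i, φ i = i) (x : FreeProdGroup α) :
    map φ x = x := by
  obtain rfl : φ = id := funext h
  exact map_id x

/-- The automorphisms of the free product given by shifting the index set `ℤ`. -/
def shift : Multiplicative ℤ →* Equiv.Perm (FreeProdGroup ℤ) where
  toFun n := ⟨map (· + n.toAdd), map (· - n.toAdd),
    fun x => (map_map _ _ x).trans (map_eq_self (fun i => add_sub_cancel_right i _) x),
    fun x => (map_map _ _ x).trans (map_eq_self (fun i => sub_add_cancel i _) x)⟩
  map_one' := Equiv.ext fun x => map_eq_self (fun i => add_zero i) x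
  map_mul' m n := Equiv.ext fun x => by
    change map (· + (m.toAdd + n.toAdd)) x = map (· + m.toAdd) (map (· + n.toAdd) x)
    rw [map_map]
    refine congrArg (fun φ => map φ x) (funext fun i => ?_)
    simp only [Function.comp_apply]
    ring

/-- An automorphism conjugates left translation by an element to left translation by its image.
Translations and shifts thus realize the semidirect product with ℤ, where conjugation by the shift
moves the indices. -/
theorem shift_mul_leftMul (n : Multiplicative ℤ) (x : FreeProdGroup ℤ) :
    shift n * leftMul x * (shift n)⁻¹ =
      leftMul (map (· + n.toAdd) x) := by
  rw [mul_inv_eq_iff_eq_mul]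
  ext1 y
  exact _root_.map_mul (map (· + n.toAdd)) x y

variable {Γ : Type*} [Group Γ] {t a d b : Γ}

/-- The homomorphism mapping the generators with index `i` to the conjugates of `a` and `b` by
`d ^ i`. -/
def conjHom (ht : t * t = 1) (hat : Commute a t) (hdt : Commute d t) (b : Γ) :
    FreeProdGroup ℤ →* Γ :=
  lift t ht (fun i => d ^ i * a * (d ^ i)⁻¹)
    (fun i => ((hdt.zpow_left i).mul_left hat).mul_left (hdt.zpow_left i).inv_left)
    fun i => d ^ i * b * (d ^ i)⁻¹

/-- The homomorphism `conjHom` is injective if the conjugation relations are the only ones that are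
satisfied by `t`, `a`, `d`, `b`. -/
theorem conjHom_injective (ht : t * t = 1) (hat : Commute a t) (hdt : Commute d t)
    (ψ : Γ →* Equiv.Perm (FreeProdGroup ℤ)) (hψt : ψ t = leftMul invol)
    (hψa : ψ a = leftMul (comGen 0)) (hψd : ψ d = shift (Multiplicative.ofAdd 1))
    (hψb : ψ b = leftMul (freeGen 0)) :
    Function.Injective (conjHom ht hat hdt b) := by
  have hd : ∀ i : ℤ, ψ d ^ i = shift (Multiplicative.ofAdd i) := fun i => by
    rw [hψd, ← map_zpow, ← ofAdd_zsmul, smul_eq_mul, mul_one]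
  -- The composite is the left regular representation, which is faithful.
  have h : ψ.comp (conjHom ht hat hdt b) = leftMul := by
    refine hom_ext ?_ (fun i => ?_) fun i => ?_
    · simp only [MonoidHom.comp_apply, conjHom, lift_invol, hψt]
    · simp only [MonoidHom.comp_apply, conjHom, lift_comGen, map_mul, map_inv, map_zpow, hd, hψa,
        shift_mul_leftMul]
      simp [map]
    · simp only [MonoidHom.comp_apply, conjHom, lift_freeGen, map_mul, map_inv, map_zpow, hd, hψb,
        shift_mul_leftMul]
      simp [map]
  have hinj : Function.Injective (ψ.comp (conjHom ht hat hdt b)) := by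
    rw [h]
    exact leftMul_injective
  exact Function.Injective.of_comp (f := ψ) (by simpa using hinj)

theorem commute_shift_invol (n : Multiplicative ℤ) :
    Commute (shift n) (leftMul invol) := by
  have := shift_mul_leftMul n invol
  rw [mul_inv_eq_iff_eq_mul] at this
  rw [Commute, SemiconjBy, this]
  simp [map]

theorem commute_leftMul_comGen (i : ℤ) :
    Commute (leftMul (comGen i))
      (leftMul invol) :=
  (commute_comGen i).map _

theorem leftMul_invol_mul_self :
    leftMul invol * leftMul invol
      = 1 := by
  rw [← map_mul, invol_mul_invol, map_one]

theorem commute_cons_shift (i : Fin 2) :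
    Commute ((![leftMul (comGen 0), shift (Multiplicative.ofAdd 1)]
      : Fin 2 → Equiv.Perm (FreeProdGroup ℤ)) i) (leftMul invol) := by
  fin_cases i
  exacts [commute_leftMul_comGen 0, commute_shift_invol _]

/-- The free product of infinite rank embeds into the one of rank two. -/
theorem exists_injective_fin_two :
    ∃ j : FreeProdGroup ℕ →* FreeProdGroup (Fin 2), Function.Injective j := by
  refine ⟨(conjHom invol_mul_invol (commute_comGen 0) (commute_comGen 1) (freeGen 0)).comp
    (map ((↑) : ℕ → ℤ)), ?_⟩
  rw [MonoidHom.coe_comp]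
  -- The second free generator plays no role in `conjHom`, so its image is arbitrary.
  refine (conjHom_injective _ _ _ (lift _ leftMul_invol_mul_self _ commute_cons_shift
    fun _ => leftMul (freeGen 0)) ?_ ?_ ?_ ?_).comp (map_injective Nat.cast_injective)
  all_goals simp

end FreeProdGroup

/-! ### Matrices and estimates for ping-pong on ℤ³. -/

namespace SLThree

open Matrix

/-- The elementary matrices in the first two coordinates. -/
def elem (i : Fin 2) (m : ℤ) : Matrix.SpecialLinearGroup (Fin 3) ℤ :=
  ⟨if i = 0 then !![1, m, 0; 0, 1, 0; 0, 0, 1] else !![1, 0, 0; m, 1, 0; 0, 0, 1], by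
    split_ifs <;> simp [det_fin_three]⟩

/-- The central involution of `GL₂(ℤ)` in the first two coordinates. -/
def negOne : Matrix.SpecialLinearGroup (Fin 3) ℤ :=
  ⟨!![-1, 0, 0; 0, -1, 0; 0, 0, 1], by simp [det_fin_three]⟩

/-- The linear form defining the fixed hyperplane of `transv`. -/
def form (v : Fin 3 → ℤ) : ℤ := v 0 + v 1 - 2 * v 2

/-- A group of transvections with direction `(1, 1, 1)`. -/
def transv (n : ℤ) : Matrix.SpecialLinearGroup (Fin 3) ℤ :=
  ⟨!![1 + 100 * n, 100 * n, -200 * n; 100 * n, 1 + 100 * n, -200 * n;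
    100 * n, 100 * n, 1 - 200 * n], by simp [det_fin_three]; ring⟩

theorem elem_zero_smul (m : ℤ) (v : Fin 3 → ℤ) : elem 0 m • v = ![v 0 + m * v 1, v 1, v 2] := by
  rw [Matrix.SpecialLinearGroup.smul_def, smul_eq_mulVec]
  ext i
  fin_cases i <;> simp [elem, mulVec, dotProduct, Fin.sum_univ_three]

theorem elem_one_smul (m : ℤ) (v : Fin 3 → ℤ) : elem 1 m • v = ![v 0, m * v 0 + v 1, v 2] := by
  rw [Matrix.SpecialLinearGroup.smul_def, smul_eq_mulVec]
  ext i
  fin_cases i <;> simp [elem, mulVec, dotProduct, Fin.sum_univ_three]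

theorem negOne_smul (v : Fin 3 → ℤ) : negOne • v = ![-v 0, -v 1, v 2] := by
  rw [Matrix.SpecialLinearGroup.smul_def, smul_eq_mulVec]
  ext i
  fin_cases i <;> simp [negOne, mulVec, dotProduct, Fin.sum_univ_three]

/-- The matrix is the identity plus 100 n times the rank one map v ↦ `form v` · (1, 1, 1). As `form`
vanishes at (1, 1, 1), these are transvections and additive in n. -/
theorem transv_smul (n : ℤ) (v : Fin 3 → ℤ) : transv n • v =
    ![v 0 + 100 * (n * form v), v 1 + 100 * (n * form v), v 2 + 100 * (n * form v)] := by
  rw [Matrix.SpecialLinearGroup.smul_def, smul_eq_mulVec]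
  ext i
  fin_cases i <;> simp [transv, form, mulVec, dotProduct, Fin.sum_univ_three] <;> ring

theorem transv_add (m n : ℤ) : transv (m + n) = transv m * transv n := by
  refine Subtype.ext ?_
  change (transv (m + n)).1 = (transv m).1 * (transv n).1
  ext i j
  fin_cases i <;> fin_cases j <;> simp [transv, mul_apply, Fin.sum_univ_three] <;> ring

theorem elem_inv (i : Fin 2) (m : ℤ) : (elem i m)⁻¹ = elem i (-m) := by
  rw [inv_eq_iff_mul_eq_one]
  refine Subtype.ext ?_
  change (elem i m).1 * (elem i (-m)).1 = 1
  ext j k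
  fin_cases i <;> fin_cases j <;> fin_cases k <;>
    simp [elem, mul_apply, Fin.sum_univ_three]

theorem negOne_mul_self : negOne * negOne = 1 := by
  refine Subtype.ext ?_
  change negOne.1 * negOne.1 = 1
  ext i j
  fin_cases i <;> fin_cases j <;> simp [negOne, mul_apply, Fin.sum_univ_three]

theorem commute_elem_negOne (i : Fin 2) (m : ℤ) : Commute (elem i m) negOne := by
  rw [Commute, SemiconjBy]
  refine Subtype.ext ?_
  change (elem i m).1 * negOne.1 = negOne.1 * (elem i m).1
  ext j k
  fin_cases i <;> fin_cases j <;> fin_cases k <;>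
    simp [elem, negOne, mul_apply, Fin.sum_univ_three]

/-- The region where the first two coordinates are as for vectors obtained from `near` by a reduced
word that starts with the given letter. -/
def cone (x : Fin 2 × Bool) (v : Fin 3 → ℤ) : Prop :=
  v 2 ≠ 0 ∧
  (if x.1 = 0 then 5 * |v 1| ≤ |v 0| ∧ 5 * |v 2| ≤ |v 0|
    else 5 * |v 0| ≤ |v 1| ∧ 5 * |v 2| ≤ |v 1|) ∧
  if x.2 then (0 ≤ v 0 ∧ 0 ≤ v 1) ∨ (v 0 ≤ 0 ∧ v 1 ≤ 0)
    else (0 ≤ v 0 ∧ v 1 ≤ 0) ∨ (v 0 ≤ 0 ∧ 0 ≤ v 1)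

/-- The vectors that are close to a multiple of `(1, 1, 1)`. -/
def near (v : Fin 3 → ℤ) : Prop :=
  v 2 ≠ 0 ∧ 10 * |v 0 - v 2| ≤ |v 2| ∧ 10 * |v 1 - v 2| ≤ |v 2|

/-- The vectors that are far from the fixed hyperplane of `transv`. -/
def far (v : Fin 3 → ℤ) : Prop :=
  v ≠ 0 ∧ |v 0| ≤ 3 * |form v| ∧ |v 1| ≤ 3 * |form v| ∧ |v 2| ≤ 3 * |form v|

theorem cone_smul_of_near {v : Fin 3 → ℤ} (hv : near v) (x : Fin 2 × Bool) :
    cone x (elem x.1 (if x.2 then 10 else -10) • v) := by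
  obtain ⟨h0, h1, h2⟩ := hv
  obtain ⟨i, b⟩ := x
  fin_cases i <;> cases b <;>
    simp only [Fin.zero_eta, Fin.mk_one, elem_zero_smul, elem_one_smul, cone, cons_val] <;>
    grind

/-- If the letter repeats, the sign condition in `cone` rules out cancellation, so the large
coordinate does not shrink. If the index changes, the added multiple of the large coordinate
dominates. -/
theorem cone_smul_of_cone {v : Fin 3 → ℤ} {x y : Fin 2 × Bool} (hxy : x.1 = y.1 → x.2 = y.2)
    (hv : cone y v) : cone x (elem x.1 (if x.2 then 10 else -10) • v) := by
  obtain ⟨h0, h1, h2⟩ := hv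
  obtain ⟨i, b⟩ := x
  obtain ⟨j, c⟩ := y
  fin_cases i <;> fin_cases j <;> cases b <;> cases c <;>
    simp [elem_zero_smul, elem_one_smul, cone] at hxy h1 h2 ⊢ <;>
    grind

/-- |`form v`| is at least 1 − 1/5 − 2/5 = 2/5 of the dominant coordinate, and 3 · 2/5 > 1. Only
absolute values matter, so the signs changed by `negOne` are harmless. -/
theorem far_of_cone {v : Fin 3 → ℤ} {x : Fin 2 × Bool} (hv : cone x v) :
    far v ∧ far (negOne • v) := by
  obtain ⟨h0, h1, -⟩ := hv
  refine ⟨⟨fun h => h0 (by simp [h]), ?_⟩, ⟨fun h => h0 (by simpa [negOne_smul] using congrFun h 2), ?_⟩⟩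
  all_goals simp only [negOne_smul, form, cons_val]
  all_goals grind

theorem far_negOne_smul_of_near {v : Fin 3 → ℤ} (hv : near v) : far (negOne • v) := by
  obtain ⟨h0, h1, h2⟩ := hv
  refine ⟨fun h => h0 (by simpa [negOne_smul] using congrFun h 2), ?_⟩
  simp only [negOne_smul, form, cons_val]
  grind

/-- With m = n · `form v`, the coordinates of v are at most 3|m|. The new ones are at least 97|m| in
size, while their differences remain at most 6|m|, and 60 ≤ 97. -/
theorem near_transv_smul_of_far {v : Fin 3 → ℤ} (hv : far v) {n : ℤ} (hn : n ≠ 0) :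
    near (transv n • v) := by
  obtain ⟨h0, h1, h2, h3⟩ := hv
  have hf : form v ≠ 0 := by
    intro hf
    rw [hf] at h1 h2 h3
    refine h0 (funext fun i => ?_)
    fin_cases i <;> simp_all
  have hn' : |form v| ≤ |n * form v| := by
    rw [abs_mul]
    exact le_mul_of_one_le_left (abs_nonneg _) (Int.one_le_abs hn)
  have hf' : 0 < |form v| := abs_pos.2 hf
  rw [transv_smul]
  generalize n * form v = m at *
  generalize form v = f at *
  simp only [near, cons_val]
  grind

theorem disjoint_near_far {v : Fin 3 → ℤ} (hv : near v) : ¬ far v := by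
  rintro ⟨-, -, -, h⟩
  obtain ⟨h0, h1, h2⟩ := hv
  simp only [form] at h
  grind

end SLThree

/-! ### Ping-pong and the faithful representation. -/

namespace SLThree

open Matrix FreeProdGroup

/-- The representation of the free group of rank two by elementary matrices. -/
def freeHom : FreeGroup (Fin 2) →* Matrix.SpecialLinearGroup (Fin 3) ℤ :=
  FreeGroup.lift fun i => elem i 10

theorem freeHom_mk_cons (x : Fin 2 × Bool) (l : List (Fin 2 × Bool)) :
    freeHom (FreeGroup.mk (x :: l)) =
      elem x.1 (if x.2 then 10 else -10) * freeHom (FreeGroup.mk l) := by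
  rcases x with ⟨i, b⟩
  cases b <;> simp [freeHom, FreeGroup.lift_mk, elem_inv]

theorem cone_freeHom_mk_smul {v : Fin 3 → ℤ} (hv : near v) (x : Fin 2 × Bool)
    (l : List (Fin 2 × Bool)) (hl : FreeGroup.IsReduced (x :: l)) :
    cone x (freeHom (FreeGroup.mk (x :: l)) • v) := by
  induction l generalizing x with
  | nil =>
    rw [freeHom_mk_cons, ← FreeGroup.one_eq_mk, map_one, mul_one]
    exact cone_smul_of_near hv x
  | cons y l ih =>
    rw [FreeGroup.isReduced_cons_cons] at hl
    rw [freeHom_mk_cons, mul_smul]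
    exact cone_smul_of_cone hl.1 (ih y hl.2)

theorem exists_cone_freeHom_smul {v : Fin 3 → ℤ} (hv : near v) {x : FreeGroup (Fin 2)}
    (hx : x ≠ 1) : ∃ y, cone y (freeHom x • v) := by
  rw [← FreeGroup.mk_toWord (x := x)]
  have hred := FreeGroup.isReduced_toWord (x := x)
  rcases h : x.toWord with _ | ⟨y, l⟩
  · exact absurd (FreeGroup.toWord_eq_nil_iff.1 h) hx
  · rw [h] at hred
    exact ⟨y, cone_freeHom_mk_smul hv y l hred⟩

/-- The representation of the product of the free group of rank two and `ℤ/2ℤ`. -/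
def prodHom : FreeGroup (Fin 2) × Multiplicative (ZMod 2) →* Matrix.SpecialLinearGroup (Fin 3) ℤ :=
  freeProdZModTwoLift negOne negOne_mul_self (fun i => elem i 10) fun i => commute_elem_negOne i 10

theorem far_prodHom_smul {v : Fin 3 → ℤ} (hv : near v)
    {x : FreeGroup (Fin 2) × Multiplicative (ZMod 2)} (hx : x ≠ 1) : far (prodHom x • v) := by
  obtain ⟨x, z⟩ := x
  have h : prodHom (x, z) = zmodTwoHom negOne negOne_mul_self z * freeHom x := by
    rw [prodHom, freeProdZModTwoLift, MonoidHom.noncommCoprod_apply']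
    rfl
  rw [h, mul_smul]
  rcases multiplicative_zmodTwo_cases z with rfl | rfl
  · obtain ⟨y, hy⟩ := exists_cone_freeHom_smul hv fun h => hx (Prod.ext h rfl)
    rw [map_one, one_smul]
    exact (far_of_cone hy).1
  · rw [zmodTwoHom_ofAdd_one]
    by_cases hx1 : x = 1
    · rw [hx1, map_one, one_smul]
      exact far_negOne_smul_of_near hv
    · obtain ⟨y, hy⟩ := exists_cone_freeHom_smul hv hx1
      exact (far_of_cone hy).2

/-- The representation of an infinite cyclic group by transvections. -/
def transvHom : Multiplicative ℤ →* Matrix.SpecialLinearGroup (Fin 3) ℤ :=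
  MonoidHom.mk' (fun n => transv n.toAdd) fun m n => transv_add m.toAdd n.toAdd

/-- The factors of the free product represented in `SL₃(ℤ)`. -/
def Factor : Bool → Type
  | true => FreeGroup (Fin 2) × Multiplicative (ZMod 2)
  | false => Multiplicative ℤ

instance : ∀ b, Group (Factor b)
  | true => inferInstanceAs (Group (FreeGroup (Fin 2) × Multiplicative (ZMod 2)))
  | false => inferInstanceAs (Group (Multiplicative ℤ))

/-- The homomorphisms from `Factor b` to a group given by homomorphisms from both factors. -/
def factorHom {G : Type*} [Group G] (φ : FreeGroup (Fin 2) × Multiplicative (ZMod 2) →* G)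
    (ψ : Multiplicative ℤ →* G) : ∀ b, Factor b →* G
  | true => φ
  | false => ψ

theorem injective_lift_factorHom :
    Function.Injective (Monoid.CoprodI.lift (factorHom prodHom transvHom)) := by
  -- Ping-pong with two factors needs one with at least three elements; the infinite cyclic factor
  -- serves.
  refine Monoid.CoprodI.lift_injective_of_ping_pong _ (Or.inr ⟨false, ?_⟩)
    (fun b => if b then {v : Fin 3 → ℤ | far v} else {v | near v}) ?_ ?_ ?_
  · have : Infinite (Factor false) := inferInstanceAs (Infinite ℤ)
    exact (Cardinal.natCast_le_aleph0 (n := 3)).trans (Cardinal.aleph0_le_mk _)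
  · rintro (_ | _)
    · exact ⟨![1, 1, 1], by simp [near]⟩
    · exact ⟨![1, 1, 0], by simp [far, form, funext_iff, Fin.forall_fin_succ]⟩
  · rintro (_ | _) (_ | _) h
    · exact absurd rfl h
    · exact Set.disjoint_left.2 fun v hv => disjoint_near_far hv
    · exact Set.disjoint_right.2 fun v hv => disjoint_near_far hv
    · exact absurd rfl h
  · rintro (_ | _) (_ | _) h
    · exact absurd rfl h
    · rintro n hn _ ⟨v, hv, rfl⟩
      exact near_transv_smul_of_far hv hn
    · rintro x hx _ ⟨v, hv, rfl⟩
      exact far_prodHom_smul hv hx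
    · exact absurd rfl h

/-- The free product of infinite rank embeds into `SL₃(ℤ)`. -/
theorem exists_injective :
    ∃ f : FreeProdGroup ℤ →* Matrix.SpecialLinearGroup (Fin 3) ℤ, Function.Injective f := by
  let ι : FreeGroup (Fin 2) × Multiplicative (ZMod 2) →* Monoid.CoprodI Factor :=
    Monoid.CoprodI.of (M := Factor) (i := true)
  let ι' : Multiplicative ℤ →* Monoid.CoprodI Factor := Monoid.CoprodI.of (M := Factor) (i := false)
  let F := factorHom
    (freeProdZModTwoLift (leftMul invol) leftMul_invol_mul_self _ commute_cons_shift)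
    (zpowersHom _ (leftMul (freeGen 0)))
  let ψ : Monoid.CoprodI Factor →* Equiv.Perm (FreeProdGroup ℤ) := Monoid.CoprodI.lift F
  have hψ : ∀ x, ψ (ι x) = freeProdZModTwoLift (leftMul invol) leftMul_invol_mul_self _
      commute_cons_shift x := fun x =>
    Monoid.CoprodI.lift_of F (i := true) (show Factor true from x)
  have hψ' : ∀ n, ψ (ι' n) = zpowersHom _ (leftMul (freeGen 0)) n := fun n =>
    Monoid.CoprodI.lift_of F (i := false) (show Factor false from n)
  have hz : ((1, Multiplicative.ofAdd 1) * (1, Multiplicative.ofAdd 1) :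
      FreeGroup (Fin 2) × Multiplicative (ZMod 2)) = 1 := Prod.ext (mul_one _) (by decide :
      (Multiplicative.ofAdd 1 * Multiplicative.ofAdd 1 : Multiplicative (ZMod 2)) = 1)
  have hcomm : ∀ i, Commute (FreeGroup.of i, 1)
      ((1, Multiplicative.ofAdd 1) : FreeGroup (Fin 2) × Multiplicative (ZMod 2)) := fun i =>
    Prod.ext ((mul_one _).trans (one_mul _).symm) ((one_mul _).trans (mul_one _).symm)
  refine ⟨(Monoid.CoprodI.lift (factorHom prodHom transvHom)).comp
    (conjHom (t := ι (1, Multiplicative.ofAdd 1)) (a := ι (FreeGroup.of 0, 1))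
      (d := ι (FreeGroup.of 1, 1)) (by rw [← map_mul, hz, map_one]) ((hcomm 0).map ι)
      ((hcomm 1).map ι) (ι' (Multiplicative.ofAdd 1))), ?_⟩
  rw [MonoidHom.coe_comp]
  refine injective_lift_factorHom.comp (conjHom_injective _ _ _ ψ ?_ ?_ ?_ ?_)
  · rw [hψ]; simp [freeProdZModTwoLift]
  · rw [hψ]; simp [freeProdZModTwoLift]
  · rw [hψ]; simp [freeProdZModTwoLift]
  · rw [hψ']; simp

end SLThree

theorem theorem2p2 :
    ∃ f : FreeProdGroup (Fin 2) →* Matrix.SpecialLinearGroup (Fin 3) ℤ,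
      Function.Injective f ∧
      ∃ H : Subgroup (Matrix.SpecialLinearGroup (Fin 3) ℤ),
        H ≤ f.range ∧
        Nonempty (H ≃* FreeProdGroup ℕ) ∧
        IsSharplyTransitiveGroup 2 H ∧
        ¬ IsSplitGroup H := by
  obtain ⟨φ, hφ⟩ := SLThree.exists_injective
  obtain ⟨j, hj⟩ := FreeProdGroup.exists_injective_fin_two
  -- The rank two group sits in `FreeProdGroup ℤ` through the indices 0 and 1.
  let f := φ.comp (FreeProdGroup.map fun i : Fin 2 => (i : ℤ))
  have hf : Function.Injective f := hφ.comp (FreeProdGroup.map_injective fun i i' h =>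
    Fin.ext (by exact_mod_cast h))
  have hfj : Function.Injective (f.comp j) := hf.comp hj
  let e : (f.comp j).range ≃* FreeProdGroup ℕ := (MonoidHom.ofInjective hfj).symm
  refine ⟨f, hf, (f.comp j).range, ?_, ⟨e⟩, isSharplyTransitiveGroup_freeProdGroup.of_mulEquiv e,
    fun h => not_isSplitGroup_freeProdGroup (h.of_mulEquiv e)⟩
  rintro _ ⟨x, rfl⟩
  exact ⟨j x, rfl⟩
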